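/- Let $\mathcal G=(\mathcal V,\mathcal E)$ be a connected finite undirected graph without self-loops, $n_i$ the set of neighbors of node $i$, $m_i=|n_i|$, and let $(i,j)$ range over the ordered pairs of adjacent nodes. For every node $i$ let $f_i:\mathbb R^p\to\mathbb R$ be differentiable and strongly concave with parameter $\mu>0$. For $\lambda=(\lambda_{ij})_{(i,j)\in\mathcal E}$ with $\lambda_{ij}\in\mathbb R^p$ put $$x_i(\lambda)=\arg\max_{x\in\mathbb R^p}\Big\{f_i(x)+\sum_{j\in n_i}(\lambda_{ij}-\lambda_{ji})^Tx\Big\},\qquad h(\lambda)=\sum_i f_i(x_i(\lambda))+\sum_{(i,j)\in\mathcal E}\lambda_{ij}^T\big(x_i(\lambda)-x_j(\lambda)\big).$$ The gradient of the dual function $h$ is $g(\lambda)=\nabla h(\lambda)$, with blocks $g_{ij}(\lambda)=x_i(\lambda)-x_j(\lambda)$. Write $\lambda_i=(\lambda_{ij})_{j\in n_i}$ and $g_i=(g_{ij})_{j\in n_i}$. *Asynchronous D-BFGS.* Node $i$ is available at the times of a set $T^i\subseteq\{0,1,2,\dots\}$. Let $\pi^i(t)=\max\{s<t: s\in T^i\}$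 (and $\pi^i(t)=0$, the time of the initial data, if there is no such $s$) and $\pi^i_j(t)=\pi^j(\pi^i(t))$. With $g(t)=g(\lambda(t))$, the information of node $i$ at time $t$ consists of its own $\lambda_i(t)$, $g_i(t)$ and of $\lambda_j(\pi^i_j(t))$, $g_j(\pi^i_j(t))$ for $j\in n_i$; their concatenations are $\lambda^i_{n_i}(t)$ and $g^i_{n_i}(t)$. Let $D_{n_i}$ be the diagonal matrix with entries $1/(m_k+1)$ on the coordinates of node $k\in n_i\cup\{i\}$. With constants $\gamma,\Gamma>0$ and stepsizes $\epsilon(t)$, node $i$ uses the direction $$e^i_{n_i}(t)=-\big(B^i(t)^{-1}+\Gamma D_{n_i}\big)\,g^i_{n_i}(t),$$ whose part on the coordinates of node $k$ is denoted $e^i_k(t)$. At every $t\in T^i$ node $i$ sends $e^i_j(t)$ to its neighbors $j$ and updates $\lambda_i(t+1)=\lambda_i(t)+\epsilon(t)d_i(t)$, where $d_i(t)$ is the sum of its own part $e^i_i(t)$ and of all the parts $e^j_i(s)$, $j\in n_i$, $s\in T^j$, that it has newly received, i.e. those with $\pi^i(\pi^i(t))\le s<\pi^i(t)$ (so the parts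 sent at times up to $\pi^i_j(t)$ are available at time $t$, and each of them is applied once); for $t\notin T^i$, $\lambda_i(t+1)=\lambda_i(t)$. With $$\tilde v=D_{n_i}\big[\lambda^i_{n_i}(t+1)-\lambda^i_{n_i}(t)\big],\qquad \tilde r=g^i_{n_i}(t+1)-g^i_{n_i}(t)-\gamma\tilde v,$$ the matrix of node $i$ is updated by $$B^i(t+1)=B^i(t)+\frac{\tilde r\tilde r^T}{\tilde r^T\tilde v}-\frac{B^i(t)\tilde v\tilde v^TB^i(t)}{\tilde v^TB^i(t)\tilde v}+\gamma I$$ if $t\in T^i$ and $\tilde r^T\tilde v>0$, and $B^i(t+1)=B^i(t)$ otherwise. The initial matrices $B^i(0)$ are symmetric positive definite. *Theorem.* Let the graph, the functions $f_i$, the constants $\gamma,\Gamma>0$, the matrices $B^i(0)$ and an integer $B>0$ be given. Then there is a sequence of stepsizes $\epsilon(t)>0$ such that, for every initial $\lambda(0)$ and all availability sets $T^i$ with $$\max\{0,t-B+1\}\le\pi^i_j(t)\le t\qquad\text{for all } i,j,t,$$ the iterates $\lambda(t)$ of asynchronous D-BFGS satisfy $\lim_{t\to\infty}g(t)=0$,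 where $g(t)=\nabla h(\lambda(t))$. -/

import Mathlib

open scoped Matrix Topology

noncomputable section

namespace DBFGS

/-! Dual variables. A dart of `G` is an ordered edge `(i, j)`; it is owned by its first node `i`.
A dual vector has a block `lam_{ij}` in `ℝ^p` for every ordered edge. -/

/-- The space of dual vectors `lam = (lam_{ij})`, with `lam_{ij} ∈ ℝ^p`. -/
abbrev DualVec {V : Type*} (G : SimpleGraph V) (p : ℕ) : Type _ :=
  EuclideanSpace ℝ (G.Dart × Fin p)

/-- The block `lam_{ij} ∈ ℝ^p` of a dual vector. -/
def block {V : Type*} {G : SimpleGraph V} {p : ℕ} (lam : DualVec G p) (d : G.Dart) :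
    EuclideanSpace ℝ (Fin p) :=
  WithLp.toLp 2 fun a => lam (d, a)

section Dual

variable {V : Type*} [Fintype V] [DecidableEq V] (G : SimpleGraph V) [DecidableRel G.Adj] {p : ℕ}
  (f : V → EuclideanSpace ℝ (Fin p) → ℝ)

/-- The local Lagrangian `f_i(x) + ∑_{j ∈ n_i} (lam_{ij} - lam_{ji})ᵀ x` of node `i`. -/
def localLagrangian (lam : DualVec G p) (i : V) (x : EuclideanSpace ℝ (Fin p)) : ℝ :=
  f i x + ∑ d : G.Dart with d.fst = i, inner ℝ (block lam d - block lam d.symm) x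

/-- The local Lagrangian maximizer `x_i(lam)`. -/
def primalMax (lam : DualVec G p) (i : V) : EuclideanSpace ℝ (Fin p) :=
  Classical.epsilon fun x => ∀ y, localLagrangian G f lam i y ≤ localLagrangian G f lam i x

/-- The dual function `h(lam) = ∑_i f_i(x_i(lam)) + ∑_{(i,j)} lam_{ij}ᵀ (x_i(lam) - x_j(lam))`. -/
def dualFun (lam : DualVec G p) : ℝ :=
  ∑ i, f i (primalMax G f lam i) +
    ∑ d : G.Dart, inner ℝ (block lam d) (primalMax G f lam d.fst - primalMax G f lam d.snd)

/-- The dual gradient as the nodes compute it: `g_{ij}(lam) = x_i(lam) - x_j(lam)`. -/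
def dualGrad (lam : DualVec G p) : DualVec G p :=
  WithLp.toLp 2 fun e => (primalMax G f lam e.1.fst - primalMax G f lam e.1.snd) e.2

end Dual

/-! Asynchronous clocks. `T i` is the set of times at which node `i` is available. -/

/-- The most recent available time strictly before `t`; it is `0` (the time of the initial data)
if there is none. -/
def lastActive (T : Set ℕ) (t : ℕ) : ℕ :=
  sSup {s | s < t ∧ s ∈ T}

/-- `π^i_j(t) = π^j(π^i(t))`: the most recent time at which `j` sent information that `i` has
received by time `t`. -/
def lastHeard {V : Type*} (T : V → Set ℕ) (i j : V) (t : ℕ) : ℕ :=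
  lastActive (T j) (lastActive (T i) t)

/-- The time stamp of the information on node `j` that node `i` uses at time `t`: its own
information is current, that of another node dates from `π^i_j(t)`. -/
def infoTime {V : Type*} [DecidableEq V] (T : V → Set ℕ) (i j : V) (t : ℕ) : ℕ :=
  if j = i then t else lastHeard T i j t

open Classical in
/-- The activation times `s` of node `j` whose messages have been received by node `i` by time `t`
(`s < π^i(t)`), but had not been received by the preceding activation `π^i(t)` of node `i`
(`π^i(π^i(t)) ≤ s`). -/
def newMessages {V : Type*} (T : V → Set ℕ) (i j : V) (t : ℕ) : Finset ℕ :=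
  {s ∈ Finset.range t | s ∈ T j ∧
    lastActive (T i) (lastActive (T i) t) ≤ s ∧ s < lastActive (T i) t}

/-- The hypothesis `max {0, t - B + 1} ≤ π^i_j(t) ≤ t` for all `i`, `j`, `t`. -/
def PartiallyAsync {V : Type*} (T : V → Set ℕ) (B : ℕ) : Prop :=
  ∀ i j : V, ∀ t : ℕ,
    max 0 ((t : ℤ) - (B : ℤ) + 1) ≤ (lastHeard T i j t : ℤ) ∧ lastHeard T i j t ≤ t

/-! The neighborhood quantities of node `i`, indexed by the coordinates of the dual variables owned
by `i` or by a neighbor of `i`. -/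

/-- Indices of the coordinates of `lam_{n_i}`, the concatenation of `lam_i` and of the `lam_j`
with `j` adjacent to `i`. -/
abbrev NbhdIdx {V : Type*} (G : SimpleGraph V) (p : ℕ) (i : V) : Type _ :=
  {d : G.Dart // d.fst = i ∨ G.Adj i d.fst} × Fin p

section Nbhd

variable {V : Type*} [Fintype V] [DecidableEq V] (G : SimpleGraph V) [DecidableRel G.Adj] {p : ℕ}

/-- The diagonal matrix `D_{n_i}`, with entries `1 / (m_j + 1)` on the coordinates of node `j`. -/
def scaling (i : V) : Matrix (NbhdIdx G p i) (NbhdIdx G p i) ℝ :=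
  Matrix.diagonal fun e => 1 / ((G.degree e.1.1.fst : ℝ) + 1)

/-- What node `i` knows at time `t` about the neighborhood part of a global sequence `z`. -/
def localView (T : V → Set ℕ) (z : ℕ → DualVec G p) (i : V) (t : ℕ) : NbhdIdx G p i → ℝ :=
  fun e => z (infoTime T i e.1.1.fst t) (e.1.1, e.2)

/-- The modified neighborhood variable variation. -/
def varVariation (T : V → Set ℕ) (lam : ℕ → DualVec G p) (i : V) (t : ℕ) : NbhdIdx G p i → ℝ :=
  scaling G i *ᵥ (localView G T lam i (t + 1) - localView G T lam i t)

/-- The modified neighborhood gradient variation, where `g` is the sequence of dual gradients. -/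
def gradVariation (γ : ℝ) (T : V → Set ℕ) (lam g : ℕ → DualVec G p) (i : V) (t : ℕ) :
    NbhdIdx G p i → ℝ :=
  localView G T g i (t + 1) - localView G T g i t - γ • varVariation G T lam i t

/-- The neighborhood descent direction `e^i_{n_i}(t) = -(B^i(t)⁻¹ + Γ D_{n_i}) g^i_{n_i}(t)`. -/
def localDirection (Γ : ℝ) (T : V → Set ℕ)
    (Bm : (i : V) → ℕ → Matrix (NbhdIdx G p i) (NbhdIdx G p i) ℝ) (g : ℕ → DualVec G p)
    (i : V) (t : ℕ) : NbhdIdx G p i → ℝ :=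
  -(((Bm i t)⁻¹ + Γ • scaling G i) *ᵥ localView G T g i t)

/-- The same direction as a function of all dual coordinates, zero outside the neighborhood. On the
coordinates owned by `k` it is the part `e^i_k(t)`. -/
def localDirectionExt (Γ : ℝ) (T : V → Set ℕ)
    (Bm : (i : V) → ℕ → Matrix (NbhdIdx G p i) (NbhdIdx G p i) ℝ) (g : ℕ → DualVec G p)
    (i : V) (t : ℕ) (e : G.Dart × Fin p) : ℝ :=
  if he : e.1.fst = i ∨ G.Adj i e.1.fst then
    localDirection G Γ T Bm g i t (⟨e.1, he⟩, e.2)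
  else 0

open Classical in
/-- The coordinate `e = ((i, j), a)` of the direction `d_i(t)` that the owner `i` of `e` applies at
time `t`: its own part plus all the parts that it has newly received from its neighbors if it is
available, and zero otherwise. -/
def appliedDirection (Γ : ℝ) (T : V → Set ℕ)
    (Bm : (i : V) → ℕ → Matrix (NbhdIdx G p i) (NbhdIdx G p i) ℝ) (g : ℕ → DualVec G p)
    (t : ℕ) (e : G.Dart × Fin p) : ℝ :=
  if t ∈ T e.1.fst then
    localDirectionExt G Γ T Bm g e.1.fst t e +
      ∑ j ∈ G.neighborFinset e.1.fst, ∑ s ∈ newMessages T e.1.fst j t,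
        localDirectionExt G Γ T Bm g j s e
  else 0

end Nbhd

/-- The regularized BFGS update
`B + r rᵀ / (rᵀ v) - B v vᵀ B / (vᵀ B v) + γ I`. -/
def bfgsUpdate {ι : Type*} [Fintype ι] [DecidableEq ι] (γ : ℝ) (B : Matrix ι ι ℝ) (v r : ι → ℝ) :
    Matrix ι ι ℝ :=
  B + (1 / (r ⬝ᵥ v)) • Matrix.vecMulVec r r
    - (1 / (v ⬝ᵥ (B *ᵥ v))) • Matrix.vecMulVec (B *ᵥ v) (v ᵥ* B) + γ • (1 : Matrix ι ι ℝ)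

open Classical in
/-- `lam` and `Bm` are the dual iterates and the curvature matrices of asynchronous D-BFGS with
regularization constants `γ`, `Γ`, stepsize `ε`, availability sets `T` and initial matrices `B0`
(the initial dual variable is `lam 0`). Node `i` updates its matrix at the times at which it is
available and the inner product of its two variations is positive; otherwise it keeps it. -/
structure IsAsyncRun {V : Type*} [Fintype V] [DecidableEq V] (G : SimpleGraph V)
    [DecidableRel G.Adj] {p : ℕ} (f : V → EuclideanSpace ℝ (Fin p) → ℝ) (γ Γ : ℝ) (ε : ℕ → ℝ)
    (T : V → Set ℕ) (B0 : (i : V) → Matrix (NbhdIdx G p i) (NbhdIdx G p i) ℝ)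
    (lam : ℕ → DualVec G p)
    (Bm : (i : V) → ℕ → Matrix (NbhdIdx G p i) (NbhdIdx G p i) ℝ) : Prop where
  init : ∀ i, Bm i 0 = B0 i
  step : ∀ t e, lam (t + 1) e =
    lam t e + ε t * appliedDirection G Γ T Bm (fun s => dualGrad G f (lam s)) t e
  curvature : ∀ i t, Bm i (t + 1) =
    if t ∈ T i ∧ 0 < gradVariation G γ T lam (fun s => dualGrad G f (lam s)) i t ⬝ᵥ
        varVariation G T lam i t then
      bfgsUpdate γ (Bm i t) (varVariation G T lam i t)
        (gradVariation G γ T lam (fun s => dualGrad G f (lam s)) i t)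
    else Bm i t

end DBFGS

end

/-!
The proof uses a constant stepsize `ε`, small in terms of the given data only.

*The dual function.* Each local Lagrangian is strongly concave, hence has a maximizer, away from
which it drops at least quadratically. The Lagrangian is affine in the multiplier, so `dualFun` is
a maximum of affine functions, with a quadratic gap that measures how far the maximizers move
(`dualFun_add_inner_add_le`). This makes `dualGrad` cocoercive, hence Lipschitz
(`norm_dualGrad_sub_le`), gives the upper quadratic bound `dualFun_le`, and identifies `dualGrad`
as the gradient. By weak duality the dual function is bounded below.

*The curvature matrices.* The term `γ I` keeps every updated matrix above `γ I`, so the inverses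
are uniformly bounded; the term `Γ D` makes every local direction uniformly descending for the
local view of the gradient from which it is computed
(`IsAsyncRun.localView_dotProduct_localDirection_le`).

*Asynchrony.* The parts of a single direction are applied at different times by different nodes,
and only all of them together are known to be a descent direction. Therefore one follows the
*virtual iterate*, which applies each direction as a whole at the time at which it is computed.
Each message is applied exactly once (`IsAsyncRun.iterate_apply`), so the virtual iterate differs
from the true one by the messages under way, all of which were computed in the last `B` units of
time. With `b(t)` the norm of all local views used at time `t` (`viewNorm`), it follows that the
dual function decreases along the virtual iterates by at least `ε c b(t)²`, up to an error of
order `ε²` times a sum of products `b(s) b(t)` over the recent times `s`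
(`IsAsyncRun.tendsto_viewNorm`). For small `ε` the sequence `b` is square summable
(`tendsto_zero_of_delayed_descent`). As every node is active in every window of length `B`, `b`
controls the true gradient (`IsAsyncRun.norm_dualGrad_le`).
-/

noncomputable section

namespace DBFGS

/-! ### Maximizers of strongly concave functions -/

/-- A continuous strongly concave function on a proper space attains its maximum: along a ray from
the origin, its growth between `0` and the unit ball is eventually beaten by the quadratic term. -/
theorem exists_forall_le_of_strongConcaveOn {E : Type*} [NormedAddCommGroup E] [NormedSpace ℝ E]
    [ProperSpace E] {F : E → ℝ} {μ : ℝ} (hμ : 0 < μ) (hF : StrongConcaveOn Set.univ μ F)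
    (hc : Continuous F) : ∃ x, ∀ y, F y ≤ F x := by
  obtain ⟨q, -, hq⟩ := (isCompact_closedBall (0 : E) 1).exists_isMaxOn
    ⟨0, by simp⟩ hc.continuousOn
  have hq0 : F 0 ≤ F q := hq (by simp)
  set R : ℝ := 1 + 2 * (F q - F 0) / μ with hR
  have hR1 : 1 ≤ R := by
    have : 0 ≤ 2 * (F q - F 0) / μ := by have := sub_nonneg.2 hq0; positivity
    linarith
  obtain ⟨x, -, hx⟩ := (isCompact_closedBall (0 : E) R).exists_isMaxOn
    ⟨0, by simp; linarith⟩ hc.continuousOn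
  refine ⟨x, fun y => ?_⟩
  by_cases hy : ‖y‖ ≤ R
  · exact hx (by simpa using hy)
  · push Not at hy
    refine le_trans ?_ (hx (show (0 : E) ∈ Metric.closedBall 0 R by simp; linarith))
    have hy1 : 1 < ‖y‖ := lt_of_le_of_lt hR1 hy
    have hy0 : 0 < ‖y‖ := by linarith
    have h := hF.2 (Set.mem_univ y) (Set.mem_univ 0) (show 0 ≤ ‖y‖⁻¹ by positivity)
      (show 0 ≤ 1 - ‖y‖⁻¹ from sub_nonneg.2 (inv_le_one_of_one_le₀ hy1.le)) (by ring)
    have hp : F (‖y‖⁻¹ • y + (1 - ‖y‖⁻¹) • (0 : E)) ≤ F q := by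
      apply hq
      simp [norm_smul, hy0.ne']
    simp only [smul_eq_mul, sub_zero] at h
    have h1 := mul_le_mul_of_nonneg_left (h.trans hp) hy0.le
    have h2 : ‖y‖ * (‖y‖⁻¹ * F y + (1 - ‖y‖⁻¹) * F 0
        + ‖y‖⁻¹ * (1 - ‖y‖⁻¹) * (μ / 2 * ‖y‖ ^ 2)) =
        F y + (‖y‖ - 1) * F 0 + (‖y‖ - 1) * (μ / 2 * ‖y‖) := by
      field_simp
    rw [h2] at h1
    have h3 : 2 * (F q - F 0) ≤ (‖y‖ - 1) * μ := by
      rw [← div_le_iff₀ hμ]; linarith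
    nlinarith [mul_le_mul_of_nonneg_left h3 hy0.le]

/-- A strongly concave function drops at least quadratically away from a maximizer. -/
theorem add_sq_dist_le_of_strongConcaveOn {E : Type*} [NormedAddCommGroup E] [NormedSpace ℝ E]
    {F : E → ℝ} {μ : ℝ} (hF : StrongConcaveOn Set.univ μ F) {x : E} (hx : ∀ y, F y ≤ F x) (y : E) :
    F y + μ / 2 * ‖y - x‖ ^ 2 ≤ F x := by
  have key : ∀ s ∈ Set.Ioo (0 : ℝ) 1, F y + (1 - s) * (μ / 2 * ‖y - x‖ ^ 2) ≤ F x := by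
    rintro s ⟨hs0, hs1⟩
    have h := (hF.2 (Set.mem_univ y) (Set.mem_univ x) hs0.le
      (show 0 ≤ 1 - s by linarith) (by ring)).trans (hx _)
    simp only [smul_eq_mul] at h
    refine le_of_mul_le_mul_left ?_ hs0
    linarith
  have hlim : Filter.Tendsto (fun s : ℝ => F y + (1 - s) * (μ / 2 * ‖y - x‖ ^ 2)) (𝓝[>] 0)
      (𝓝 (F y + (1 - 0) * (μ / 2 * ‖y - x‖ ^ 2))) :=
    Filter.Tendsto.mono_left (Continuous.tendsto (by fun_prop) 0) nhdsWithin_le_nhds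
  have := le_of_tendsto hlim
    (Filter.eventually_of_mem (Ioo_mem_nhdsGT (zero_lt_one' ℝ)) key)
  simpa using this

/-! ### The dual function -/

/-- A Lipschitz constant of the dual gradient. -/
def dualLip {V : Type*} [Fintype V] (G : SimpleGraph V) [DecidableRel G.Adj] (μ : ℝ) : ℝ :=
  4 * Fintype.card G.Dart / μ

theorem dualLip_nonneg {V : Type*} [Fintype V] {G : SimpleGraph V} [DecidableRel G.Adj] {μ : ℝ}
    (hμ : 0 < μ) : 0 ≤ dualLip G μ := by
  unfold dualLip; positivity

theorem sum_inner_block_eq_inner {V : Type*} [Fintype V] {G : SimpleGraph V}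
    [DecidableRel G.Adj] {p : ℕ} (lam : DualVec G p)
    (x : V → EuclideanSpace ℝ (Fin p)) :
    ∑ d : G.Dart, inner ℝ (block lam d) (x d.fst - x d.snd) =
      inner ℝ (WithLp.toLp 2 fun e => (x e.1.fst - x e.1.snd) e.2 : DualVec G p) lam := by
  simp [PiLp.inner_apply, Fintype.sum_prod_type, block, mul_comm]

section Dual

variable {V : Type*} [Fintype V] (G : SimpleGraph V) [DecidableRel G.Adj] {p : ℕ}
  (f : V → EuclideanSpace ℝ (Fin p) → ℝ)

/-- The Lagrangian `∑_i f_i(x_i) + ∑_{(i,j)} lam_{ij}ᵀ (x_i - x_j)` of the consensus problem. -/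
def lagrangian (lam : DualVec G p) (x : V → EuclideanSpace ℝ (Fin p)) : ℝ :=
  ∑ i, f i (x i) + ∑ d : G.Dart, inner ℝ (block lam d) (x d.fst - x d.snd)

/-- The Lagrangian is affine in the multiplier. -/
theorem lagrangian_sub (lam lam' : DualVec G p) (x : V → EuclideanSpace ℝ (Fin p)) :
    lagrangian G f lam' x = lagrangian G f lam x +
      inner ℝ (WithLp.toLp 2 fun e => (x e.1.fst - x e.1.snd) e.2 : DualVec G p) (lam' - lam) := by
  unfold lagrangian
  rw [sum_inner_block_eq_inner, sum_inner_block_eq_inner, inner_sub_right]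
  ring

variable [DecidableEq V]

theorem lagrangian_eq_sum_localLagrangian (lam : DualVec G p)
    (x : V → EuclideanSpace ℝ (Fin p)) :
    lagrangian G f lam x = ∑ i, localLagrangian G f lam i (x i) := by
  unfold lagrangian localLagrangian
  rw [Finset.sum_add_distrib]
  congr 1
  have h1 : ∑ i, ∑ d : G.Dart with d.fst = i, inner ℝ (block lam d - block lam d.symm) (x i)
      = ∑ d : G.Dart, inner ℝ (block lam d - block lam d.symm) (x d.fst) := by
    rw [← Finset.sum_fiberwise_of_maps_to (s := Finset.univ) (t := Finset.univ)
      (g := fun d : G.Dart => d.fst) (fun _ _ => Finset.mem_univ _)]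
    refine Finset.sum_congr rfl fun i _ => Finset.sum_congr rfl fun d hd => ?_
    rw [(Finset.mem_filter.1 hd).2]
  rw [h1]
  simp only [inner_sub_left, inner_sub_right, Finset.sum_sub_distrib]
  congr 1
  exact Fintype.sum_equiv (Function.Involutive.toPerm _ SimpleGraph.Dart.symm_involutive) _ _
    fun d => by simp [Function.Involutive.toPerm]

theorem dualFun_eq_lagrangian (lam : DualVec G p) :
    dualFun G f lam = lagrangian G f lam (primalMax G f lam) := rfl

variable {G f} {μ : ℝ}

theorem localLagrangian_eq (lam : DualVec G p) (i : V) : localLagrangian G f lam i = fun x =>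
    f i x + inner ℝ (∑ d : G.Dart with d.fst = i, (block lam d - block lam d.symm)) x := by
  funext x
  rw [localLagrangian, sum_inner]

theorem strongConcaveOn_localLagrangian (hconc : ∀ i, StrongConcaveOn Set.univ μ (f i))
    (lam : DualVec G p) (i : V) : StrongConcaveOn Set.univ μ (localLagrangian G f lam i) := by
  rw [localLagrangian_eq]
  refine ⟨convex_univ, fun x hx y hy a b ha hb hab => ?_⟩
  have := (hconc i).2 hx hy ha hb hab
  simp only [smul_eq_mul, inner_add_right, inner_smul_right] at this ⊢
  linarith

theorem primalMax_spec (hμ : 0 < μ) (hdiff : ∀ i, Differentiable ℝ (f i))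
    (hconc : ∀ i, StrongConcaveOn Set.univ μ (f i)) (lam : DualVec G p) (i : V)
    (y : EuclideanSpace ℝ (Fin p)) :
    localLagrangian G f lam i y ≤ localLagrangian G f lam i (primalMax G f lam i) := by
  have hc : Continuous (localLagrangian G f lam i) := by
    rw [localLagrangian_eq]
    have := (hdiff i).continuous
    fun_prop
  exact Classical.epsilon_spec (exists_forall_le_of_strongConcaveOn hμ
    (strongConcaveOn_localLagrangian hconc lam i) hc) y

theorem lagrangian_add_le_dualFun (hμ : 0 < μ) (hdiff : ∀ i, Differentiable ℝ (f i))
    (hconc : ∀ i, StrongConcaveOn Set.univ μ (f i)) (lam : DualVec G p)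
    (x : V → EuclideanSpace ℝ (Fin p)) :
    lagrangian G f lam x + μ / 2 * ∑ i, ‖x i - primalMax G f lam i‖ ^ 2 ≤ dualFun G f lam := by
  rw [dualFun_eq_lagrangian, lagrangian_eq_sum_localLagrangian, lagrangian_eq_sum_localLagrangian,
    Finset.mul_sum, ← Finset.sum_add_distrib]
  exact Finset.sum_le_sum fun i _ => add_sq_dist_le_of_strongConcaveOn
    (strongConcaveOn_localLagrangian hconc lam i) (primalMax_spec hμ hdiff hconc lam i) (x i)

/-- Weak duality at the consensus point `0`. -/
theorem sum_apply_zero_le_dualFun (hμ : 0 < μ) (hdiff : ∀ i, Differentiable ℝ (f i))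
    (hconc : ∀ i, StrongConcaveOn Set.univ μ (f i)) (lam : DualVec G p) :
    ∑ i, f i 0 ≤ dualFun G f lam := by
  have h := lagrangian_add_le_dualFun hμ hdiff hconc lam (fun _ => 0)
  have h0 : 0 ≤ μ / 2 * ∑ i, ‖0 - primalMax G f lam i‖ ^ 2 := by positivity
  have h1 : lagrangian G f lam (fun _ => 0) = ∑ i, f i 0 := by simp [lagrangian]
  linarith

theorem norm_sq_dualGrad_sub_le (lam lam' : DualVec G p) :
    ‖dualGrad G f lam' - dualGrad G f lam‖ ^ 2 ≤ 4 * Fintype.card G.Dart *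
      ∑ i, ‖primalMax G f lam i - primalMax G f lam' i‖ ^ 2 := by
  set δ := fun i => primalMax G f lam' i - primalMax G f lam i with hδ
  have h1 : ‖dualGrad G f lam' - dualGrad G f lam‖ ^ 2 =
      ∑ d : G.Dart, ‖δ d.fst - δ d.snd‖ ^ 2 := by
    simp only [EuclideanSpace.norm_sq_eq, Fintype.sum_prod_type]
    refine Finset.sum_congr rfl fun d _ => Finset.sum_congr rfl fun a _ => ?_
    congr 2
    simp [dualGrad, hδ]
    ring
  have h2 : ∀ i, ‖δ i‖ ^ 2 ≤ ∑ i, ‖δ i‖ ^ 2 := fun i =>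
    Finset.single_le_sum (f := fun i => ‖δ i‖ ^ 2) (fun _ _ => by positivity) (Finset.mem_univ i)
  have h3 : ∀ d : G.Dart, ‖δ d.fst - δ d.snd‖ ^ 2 ≤ 4 * ∑ i, ‖δ i‖ ^ 2 := fun d => by
    have h4 := norm_sub_le (δ d.fst) (δ d.snd)
    have h5 := pow_le_pow_left₀ (norm_nonneg _) h4 2
    nlinarith [h2 d.fst, h2 d.snd, sq_nonneg (‖δ d.fst‖ - ‖δ d.snd‖)]
  rw [h1]
  refine (Finset.sum_le_sum fun d _ => h3 d).trans (le_of_eq ?_)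
  simp only [Finset.sum_const, Finset.card_univ, nsmul_eq_mul, hδ]
  simp_rw [norm_sub_rev (primalMax G f lam' _)]
  ring

theorem dualFun_add_inner_add_le (hμ : 0 < μ) (hdiff : ∀ i, Differentiable ℝ (f i))
    (hconc : ∀ i, StrongConcaveOn Set.univ μ (f i)) (lam lam' : DualVec G p) :
    dualFun G f lam + inner ℝ (dualGrad G f lam) (lam' - lam) +
      μ / 2 * ∑ i, ‖primalMax G f lam i - primalMax G f lam' i‖ ^ 2 ≤ dualFun G f lam' := by
  have h := lagrangian_add_le_dualFun hμ hdiff hconc lam' (primalMax G f lam)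
  rw [lagrangian_sub G f lam lam', ← dualFun_eq_lagrangian] at h
  exact h

/-- The dual gradient is Lipschitz because it is cocoercive, which comes from adding the quadratic
lower bounds for `(lam, lam')` and `(lam', lam)`. -/
theorem norm_dualGrad_sub_le (hμ : 0 < μ) (hdiff : ∀ i, Differentiable ℝ (f i))
    (hconc : ∀ i, StrongConcaveOn Set.univ μ (f i)) (lam lam' : DualVec G p) :
    ‖dualGrad G f lam' - dualGrad G f lam‖ ≤ dualLip G μ * ‖lam' - lam‖ := by
  have h1 := dualFun_add_inner_add_le hμ hdiff hconc lam lam'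
  have h2 := dualFun_add_inner_add_le hμ hdiff hconc lam' lam
  have h3 := norm_sq_dualGrad_sub_le (f := f) lam lam'
  have h4 := norm_sq_dualGrad_sub_le (f := f) lam' lam
  simp only [norm_sub_rev (primalMax G f lam' _)] at h2
  set S := ∑ i, ‖primalMax G f lam i - primalMax G f lam' i‖ ^ 2
  have h5 : μ * S ≤ inner ℝ (dualGrad G f lam' - dualGrad G f lam) (lam' - lam) := by
    rw [← neg_sub lam' lam, inner_neg_right] at h2
    rw [inner_sub_left]
    linarith
  have h6 := h5.trans (real_inner_le_norm _ _)
  have h7 : ‖dualGrad G f lam' - dualGrad G f lam‖ * ‖dualGrad G f lam' - dualGrad G f lam‖ ≤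
      ‖dualGrad G f lam' - dualGrad G f lam‖ * (dualLip G μ * ‖lam' - lam‖) := by
    have h8 : 4 * Fintype.card G.Dart * S = dualLip G μ * (μ * S) := by
      unfold dualLip; field_simp
    calc _ ≤ 4 * Fintype.card G.Dart * S := by rw [← sq]; exact h3
      _ = dualLip G μ * (μ * S) := h8
      _ ≤ dualLip G μ * _ := mul_le_mul_of_nonneg_left h6 (dualLip_nonneg hμ)
      _ = _ := by ring
  rcases (norm_nonneg (dualGrad G f lam' - dualGrad G f lam)).eq_or_lt with h0 | h0
  · rw [← h0]
    have := dualLip_nonneg (G := G) hμ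
    positivity
  · exact le_of_mul_le_mul_left h7 h0

theorem dualFun_add_inner_le (hμ : 0 < μ) (hdiff : ∀ i, Differentiable ℝ (f i))
    (hconc : ∀ i, StrongConcaveOn Set.univ μ (f i)) (lam lam' : DualVec G p) :
    dualFun G f lam + inner ℝ (dualGrad G f lam) (lam' - lam) ≤ dualFun G f lam' := by
  have h := dualFun_add_inner_add_le hμ hdiff hconc lam lam'
  have : 0 ≤ μ / 2 * ∑ i, ‖primalMax G f lam i - primalMax G f lam' i‖ ^ 2 := by positivity
  linarith

theorem dualFun_le (hμ : 0 < μ) (hdiff : ∀ i, Differentiable ℝ (f i))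
    (hconc : ∀ i, StrongConcaveOn Set.univ μ (f i)) (lam lam' : DualVec G p) :
    dualFun G f lam' ≤ dualFun G f lam + inner ℝ (dualGrad G f lam) (lam' - lam) +
      dualLip G μ * ‖lam' - lam‖ ^ 2 := by
  have h1 := dualFun_add_inner_le hμ hdiff hconc lam' lam
  have h2 := real_inner_le_norm (dualGrad G f lam' - dualGrad G f lam) (lam' - lam)
  have h3 := mul_le_mul_of_nonneg_right (norm_dualGrad_sub_le hμ hdiff hconc lam lam')
    (norm_nonneg (lam' - lam))
  rw [← neg_sub lam' lam, inner_neg_right] at h1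
  rw [inner_sub_left] at h2
  nlinarith

theorem hasGradientAt_dualFun (hμ : 0 < μ) (hdiff : ∀ i, Differentiable ℝ (f i))
    (hconc : ∀ i, StrongConcaveOn Set.univ μ (f i)) (lam : DualVec G p) :
    HasGradientAt (dualFun G f) (dualGrad G f lam) lam := by
  rw [hasGradientAt_iff_isLittleO]
  have h1 : (fun x' => dualFun G f x' - dualFun G f lam - inner ℝ (dualGrad G f lam) (x' - lam))
      =O[𝓝 lam] fun x' => ‖x' - lam‖ ^ 2 := by
    refine Asymptotics.IsBigO.of_bound (dualLip G μ) (Filter.Eventually.of_forall fun x' => ?_)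
    have := dualFun_add_inner_le hμ hdiff hconc lam x'
    have := dualFun_le hμ hdiff hconc lam x'
    rw [Real.norm_of_nonneg (by linarith), Real.norm_of_nonneg (by positivity)]
    linarith
  refine h1.trans_isLittleO ?_
  have h2 := (Asymptotics.isLittleO_norm_pow_id (E' := DualVec G p) one_lt_two).comp_tendsto
    (tendsto_sub_nhds_zero_iff.2 (Filter.tendsto_id (x := 𝓝 lam)))
  exact h2

end Dual

/-! ### The curvature matrices -/

section Curvature

variable {ι : Type*} [Fintype ι]

theorem dotProduct_mulVec_comm_of_isHermitian {A : Matrix ι ι ℝ} (hA : A.IsHermitian)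
    (x y : ι → ℝ) : x ⬝ᵥ (A *ᵥ y) = y ⬝ᵥ (A *ᵥ x) := by
  have h : Aᵀ = A := by simpa [Matrix.IsHermitian] using hA
  rw [Matrix.dotProduct_mulVec, dotProduct_comm, ← Matrix.mulVec_transpose, h]

theorem sq_dotProduct_mulVec_le {A : Matrix ι ι ℝ} (hA : A.PosDef) {v : ι → ℝ}
    (hv : 0 < v ⬝ᵥ (A *ᵥ v)) (x : ι → ℝ) :
    (v ⬝ᵥ (A *ᵥ x)) ^ 2 / (v ⬝ᵥ (A *ᵥ v)) ≤ x ⬝ᵥ (A *ᵥ x) := by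
  set s := (v ⬝ᵥ (A *ᵥ x)) / (v ⬝ᵥ (A *ᵥ v)) with hs
  have h := hA.posSemidef.dotProduct_mulVec_nonneg (x - s • v)
  simp only [star_trivial, Matrix.mulVec_sub, Matrix.mulVec_smul, sub_dotProduct, dotProduct_sub,
    smul_dotProduct, dotProduct_smul, smul_eq_mul] at h
  rw [dotProduct_mulVec_comm_of_isHermitian hA.isHermitian x v] at h
  have h1 : s * (v ⬝ᵥ (A *ᵥ v)) = v ⬝ᵥ (A *ᵥ x) := by rw [hs]; field_simp
  have h2 : (v ⬝ᵥ (A *ᵥ x)) ^ 2 / (v ⬝ᵥ (A *ᵥ v)) = s * (v ⬝ᵥ (A *ᵥ x)) := by rw [hs]; ring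
  rw [h2]
  rw [h1] at h
  linarith

theorem posDef_of_le {δ : ℝ} (hδ : 0 < δ) {A : Matrix ι ι ℝ} (hA : A.IsHermitian)
    (h : ∀ x, δ * (x ⬝ᵥ x) ≤ x ⬝ᵥ (A *ᵥ x)) : A.PosDef := by
  refine Matrix.PosDef.of_dotProduct_mulVec_pos hA fun x hx => ?_
  rw [star_trivial]
  refine lt_of_lt_of_le (mul_pos hδ ?_) (h x)
  simpa using Matrix.dotProduct_star_self_pos_iff.2 hx

theorem abs_le_sqrt_dotProduct_self (x : ι → ℝ) (e : ι) : |x e| ≤ √(x ⬝ᵥ x) := by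
  refine Real.abs_le_sqrt ?_
  rw [sq]
  exact Finset.single_le_sum (f := fun e => x e * x e) (fun e _ => mul_self_nonneg _)
    (Finset.mem_univ e)

theorem abs_mulVec_le_of_abs_le (A : Matrix ι ι ℝ) (x : ι → ℝ) (e : ι) :
    |(A *ᵥ x) e| ≤ (∑ e, ∑ e', |A e e'|) * √(x ⬝ᵥ x) := by
  calc |(A *ᵥ x) e| ≤ ∑ e', |A e e'| * |x e'| := by
        simp only [Matrix.mulVec, dotProduct, ← abs_mul]
        exact Finset.abs_sum_le_sum_abs _ _
    _ ≤ ∑ e', |A e e'| * √(x ⬝ᵥ x) := Finset.sum_le_sum fun e' _ =>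
        mul_le_mul_of_nonneg_left (abs_le_sqrt_dotProduct_self x e') (abs_nonneg _)
    _ = (∑ e', |A e e'|) * √(x ⬝ᵥ x) := by rw [Finset.sum_mul]
    _ ≤ _ := mul_le_mul_of_nonneg_right (Finset.single_le_sum (f := fun e => ∑ e', |A e e'|)
        (fun e _ => Finset.sum_nonneg fun _ _ => abs_nonneg _) (Finset.mem_univ e))
        (Real.sqrt_nonneg _)

variable [DecidableEq ι]

theorem isHermitian_bfgsUpdate {γ : ℝ} {A : Matrix ι ι ℝ} (hA : A.IsHermitian) (v r : ι → ℝ) :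
    (bfgsUpdate γ A v r).IsHermitian := by
  have h : Aᵀ = A := by simpa [Matrix.IsHermitian] using hA
  have h1 : v ᵥ* A = A *ᵥ v := by rw [← Matrix.mulVec_transpose, h]
  unfold Matrix.IsHermitian bfgsUpdate
  rw [h1, Matrix.conjTranspose_eq_transpose_of_trivial]
  simp [Matrix.transpose_add, Matrix.transpose_sub, Matrix.transpose_smul, h,
    Matrix.transpose_vecMulVec]

/-- The regularization keeps the updated matrix above `γ I`: the rank-one term that is added is
positive, and by Cauchy-Schwarz the one that is subtracted leaves `A` positive semidefinite. -/
theorem le_dotProduct_bfgsUpdate_mulVec {γ : ℝ} {A : Matrix ι ι ℝ} (hA : A.PosDef) {v r : ι → ℝ}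
    (hrv : 0 < r ⬝ᵥ v) (x : ι → ℝ) :
    γ * (x ⬝ᵥ x) ≤ x ⬝ᵥ (bfgsUpdate γ A v r *ᵥ x) := by
  have hv0 : v ≠ 0 := by
    rintro rfl
    simp at hrv
  have hv : 0 < v ⬝ᵥ (A *ᵥ v) := by simpa using hA.dotProduct_mulVec_pos hv0
  have h1 : v ᵥ* A ⬝ᵥ x = v ⬝ᵥ (A *ᵥ x) := (Matrix.dotProduct_mulVec _ _ _).symm
  have h2 : x ⬝ᵥ (A *ᵥ v) = v ⬝ᵥ (A *ᵥ x) :=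
    dotProduct_mulVec_comm_of_isHermitian hA.isHermitian x v
  have h3 := sq_dotProduct_mulVec_le hA hv x
  have h4 : x ⬝ᵥ (bfgsUpdate γ A v r *ᵥ x) = x ⬝ᵥ (A *ᵥ x) + (r ⬝ᵥ x) ^ 2 / (r ⬝ᵥ v)
      - (v ⬝ᵥ (A *ᵥ x)) ^ 2 / (v ⬝ᵥ (A *ᵥ v)) + γ * (x ⬝ᵥ x) := by
    unfold bfgsUpdate
    simp only [Matrix.add_mulVec, Matrix.sub_mulVec, Matrix.smul_mulVec, Matrix.vecMulVec_mulVec,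
      Matrix.one_mulVec, dotProduct_add, dotProduct_sub, dotProduct_smul, smul_eq_mul,
      op_smul_eq_smul, h1, h2,
      dotProduct_comm x r]
    ring
  rw [h4]
  have : 0 ≤ (r ⬝ᵥ x) ^ 2 / (r ⬝ᵥ v) := by positivity
  linarith

/-- If `A ≥ δ I`, then `|A⁻¹ x| ≤ |x| / δ`. -/
theorem abs_inv_mulVec_le {δ : ℝ} (hδ : 0 < δ) {A : Matrix ι ι ℝ} (hA : A.IsHermitian)
    (h : ∀ x, δ * (x ⬝ᵥ x) ≤ x ⬝ᵥ (A *ᵥ x)) (x : ι → ℝ) (e : ι) :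
    |(A⁻¹ *ᵥ x) e| ≤ 1 / δ * √(x ⬝ᵥ x) := by
  set y := A⁻¹ *ᵥ x with hy
  have hdet : IsUnit A.det := (Matrix.isUnit_iff_isUnit_det _).1 (posDef_of_le hδ hA h).isUnit
  have hAy : A *ᵥ y = x := by
    rw [hy, Matrix.mulVec_mulVec, Matrix.mul_nonsing_inv _ hdet, Matrix.one_mulVec]
  have h1 := h y
  rw [hAy] at h1
  have hyy : 0 ≤ y ⬝ᵥ y := 
    Finset.sum_nonneg fun e _ => mul_self_nonneg (y e)
  have hxx : 0 ≤ x ⬝ᵥ x := 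
    Finset.sum_nonneg fun e _ => mul_self_nonneg (x e)
  have h2 : (y ⬝ᵥ x) ^ 2 ≤ (y ⬝ᵥ y) * (x ⬝ᵥ x) := by
    simpa only [dotProduct, sq] using Finset.sum_mul_sq_le_sq_mul_sq Finset.univ y x
  refine (abs_le_sqrt_dotProduct_self y e).trans (Real.sqrt_le_iff.2 ⟨by positivity, ?_⟩)
  rw [mul_pow, Real.sq_sqrt hxx, div_pow, one_pow, div_mul_eq_mul_div, one_mul,
    le_div_iff₀ (by positivity)]
  rcases hyy.eq_or_lt with h0 | h0
  · rw [← h0]; simpa using hxx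
  · have h3 : (δ * (y ⬝ᵥ y)) ^ 2 ≤ (y ⬝ᵥ y) * (x ⬝ᵥ x) :=
      (pow_le_pow_left₀ (by positivity) h1 2).trans h2
    refine le_of_mul_le_mul_left ?_ h0
    linarith

end Curvature

section Direction

variable {V : Type*} [Fintype V] [DecidableEq V] {G : SimpleGraph V} [DecidableRel G.Adj] {p : ℕ}
  {f : V → EuclideanSpace ℝ (Fin p) → ℝ} {γ Γ : ℝ} {ε : ℕ → ℝ} {T : V → Set ℕ}
  {B0 : (i : V) → Matrix (NbhdIdx G p i) (NbhdIdx G p i) ℝ} {lam : ℕ → DualVec G p}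
  {Bm : (i : V) → ℕ → Matrix (NbhdIdx G p i) (NbhdIdx G p i) ℝ}

/-- Along a run a curvature matrix stays positive definite; it is the initial one until the first
update, and at least `γ I` from then on. -/
theorem IsAsyncRun.curvature_posDef (hγ : 0 < γ) (hB0 : ∀ i, (B0 i).PosDef)
    (hrun : IsAsyncRun G f γ Γ ε T B0 lam Bm) (i : V) (t : ℕ) :
    (Bm i t).PosDef ∧ (Bm i t = B0 i ∨ ∀ x, γ * (x ⬝ᵥ x) ≤ x ⬝ᵥ (Bm i t *ᵥ x)) := by
  induction t with
  | zero => rw [hrun.init]; exact ⟨hB0 i, Or.inl rfl⟩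
  | succ t ih =>
    rw [hrun.curvature]
    split_ifs with h
    · have h1 := le_dotProduct_bfgsUpdate_mulVec (γ := γ) ih.1 h.2
      exact ⟨posDef_of_le hγ (isHermitian_bfgsUpdate ih.1.isHermitian _ _) h1, Or.inr h1⟩
    · exact ih

/-- A bound for the operators `B^i(t)⁻¹ + Γ D_{n_i}`, from the Euclidean norm to the sup norm. -/
def directionBound (γ Γ : ℝ) (B0 : (i : V) → Matrix (NbhdIdx G p i) (NbhdIdx G p i) ℝ) : ℝ :=
  ∑ i, ∑ e, ∑ e', |(B0 i)⁻¹ e e'| + 1 / γ + Γ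

theorem directionBound_nonneg (hγ : 0 < γ) (hΓ : 0 < Γ) : 0 ≤ directionBound γ Γ B0 := by
  unfold directionBound
  have : 0 ≤ ∑ i, ∑ e, ∑ e', |(B0 i)⁻¹ e e'| := Finset.sum_nonneg fun i _ =>
    Finset.sum_nonneg fun e _ => Finset.sum_nonneg fun _ _ => abs_nonneg _
  positivity

theorem IsAsyncRun.abs_inv_mulVec_le (hγ : 0 < γ) (hB0 : ∀ i, (B0 i).PosDef)
    (hrun : IsAsyncRun G f γ Γ ε T B0 lam Bm) (i : V) (t : ℕ) (x : NbhdIdx G p i → ℝ)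
    (e : NbhdIdx G p i) :
    |((Bm i t)⁻¹ *ᵥ x) e| ≤ (∑ i, ∑ e, ∑ e', |(B0 i)⁻¹ e e'| + 1 / γ) * √(x ⬝ᵥ x) := by
  have h0 : ∑ e, ∑ e', |(B0 i)⁻¹ e e'| ≤ ∑ i, ∑ e, ∑ e', |(B0 i)⁻¹ e e'| :=
    Finset.single_le_sum (f := fun i => ∑ e, ∑ e', |(B0 i)⁻¹ e e'|)
      (fun i _ => Finset.sum_nonneg fun e _ => Finset.sum_nonneg fun _ _ => abs_nonneg _)
      (Finset.mem_univ i)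
  have h1 : 0 ≤ ∑ e, ∑ e', |(B0 i)⁻¹ e e'| :=
    Finset.sum_nonneg fun e _ => Finset.sum_nonneg fun _ _ => abs_nonneg _
  have h2 : 0 < 1 / γ := by positivity
  obtain ⟨hpd, h | h⟩ := hrun.curvature_posDef hγ hB0 i t
  · rw [h]
    exact (abs_mulVec_le_of_abs_le _ x e).trans
      (mul_le_mul_of_nonneg_right (by linarith) (Real.sqrt_nonneg _))
  · exact (DBFGS.abs_inv_mulVec_le hγ hpd.isHermitian h x e).trans
      (mul_le_mul_of_nonneg_right (by linarith) (Real.sqrt_nonneg _))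

theorem IsAsyncRun.abs_localDirection_le (hγ : 0 < γ) (hΓ : 0 < Γ) (hB0 : ∀ i, (B0 i).PosDef)
    (hrun : IsAsyncRun G f γ Γ ε T B0 lam Bm) (g : ℕ → DualVec G p) (i : V) (t : ℕ)
    (e : NbhdIdx G p i) :
    |localDirection G Γ T Bm g i t e| ≤ directionBound γ Γ B0 *
      √(localView G T g i t ⬝ᵥ localView G T g i t) := by
  set x := localView G T g i t
  have h1 := hrun.abs_inv_mulVec_le hγ hB0 i t x e
  have h2 : |Γ * ((scaling G i *ᵥ x) e)| ≤ Γ * √(x ⬝ᵥ x) := by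
    rw [abs_mul, abs_of_pos hΓ]
    refine mul_le_mul_of_nonneg_left (le_trans ?_ (abs_le_sqrt_dotProduct_self x e)) hΓ.le
    rw [scaling, Matrix.mulVec_diagonal, abs_mul, abs_of_pos (by positivity)]
    refine mul_le_of_le_one_left (abs_nonneg _) ?_
    rw [div_le_one (by positivity)]
    have : (0 : ℝ) ≤ G.degree e.1.1.fst := Nat.cast_nonneg _
    linarith
  have h3 : localDirection G Γ T Bm g i t e =
      -(((Bm i t)⁻¹ *ᵥ x) e + Γ * ((scaling G i *ᵥ x) e)) := by
    simp [localDirection, Matrix.add_mulVec, Matrix.smul_mulVec, x]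
  rw [h3, abs_neg]
  refine (abs_add_le _ _).trans ?_
  unfold directionBound
  rw [add_mul]
  exact add_le_add h1 h2

/-- The regularization `Γ D` makes the directions uniformly descending for the local view. -/
theorem IsAsyncRun.localView_dotProduct_localDirection_le (hγ : 0 < γ) (hΓ : 0 < Γ)
    (hB0 : ∀ i, (B0 i).PosDef) (hrun : IsAsyncRun G f γ Γ ε T B0 lam Bm) (g : ℕ → DualVec G p)
    (i : V) (t : ℕ) :
    localView G T g i t ⬝ᵥ localDirection G Γ T Bm g i t ≤
      -(Γ / (Fintype.card V + 1) * (localView G T g i t ⬝ᵥ localView G T g i t)) := by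
  set x := localView G T g i t
  have h1 : 0 ≤ x ⬝ᵥ ((Bm i t)⁻¹ *ᵥ x) := by
    simpa using (hrun.curvature_posDef hγ hB0 i t).1.inv.posSemidef.dotProduct_mulVec_nonneg x
  have h2 : 1 / ((Fintype.card V : ℝ) + 1) * (x ⬝ᵥ x) ≤ x ⬝ᵥ (scaling G i *ᵥ x) := by
    rw [dotProduct, dotProduct, Finset.mul_sum]
    refine Finset.sum_le_sum fun e _ => ?_
    rw [scaling, Matrix.mulVec_diagonal]
    have h4 : (G.degree e.1.1.fst : ℝ) ≤ Fintype.card V :=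
      Nat.cast_le.2 (G.degree_lt_card_verts _).le
    have h5 : 1 / ((Fintype.card V : ℝ) + 1) ≤ 1 / ((G.degree e.1.1.fst : ℝ) + 1) :=
      one_div_le_one_div_of_le (by positivity) (by linarith)
    have h6 := mul_le_mul_of_nonneg_right h5 (mul_self_nonneg (x e))
    linarith
  have h3 : x ⬝ᵥ localDirection G Γ T Bm g i t =
      -(x ⬝ᵥ ((Bm i t)⁻¹ *ᵥ x) + Γ * (x ⬝ᵥ (scaling G i *ᵥ x))) := by
    simp [localDirection, Matrix.add_mulVec, Matrix.smul_mulVec, x]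
  have h7 := mul_le_mul_of_nonneg_left h2 hΓ.le
  rw [h3, div_eq_mul_one_div]
  linarith

end Direction

/-! ### Clocks -/

theorem lastActive_le (T : Set ℕ) (t : ℕ) : lastActive T t ≤ t :=
  csSup_le' fun _ hs => hs.1.le

theorem lastActive_zero (T : Set ℕ) : lastActive T 0 = 0 :=
  Nat.le_zero.1 (lastActive_le T 0)

theorem lastActive_succ_of_mem {T : Set ℕ} {t : ℕ} (ht : t ∈ T) : lastActive T (t + 1) = t :=
  IsGreatest.csSup_eq ⟨⟨t.lt_succ_self, ht⟩, fun _ hs => Nat.lt_succ_iff.1 hs.1⟩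

theorem lastActive_succ_of_notMem {T : Set ℕ} {t : ℕ} (ht : t ∉ T) :
    lastActive T (t + 1) = lastActive T t := by
  unfold lastActive
  congr 1
  ext s
  simp only [Set.mem_ofPred_eq]
  refine ⟨fun ⟨h1, h2⟩ => ⟨?_, h2⟩, fun ⟨h1, h2⟩ => ⟨by omega, h2⟩⟩
  have : s ≠ t := fun h => ht (h ▸ h2)
  omega

theorem lastActive_mem {T : Set ℕ} {t : ℕ} (h : 0 < lastActive T t) :
    lastActive T t < t ∧ lastActive T t ∈ T := by
  have hne : {s | s < t ∧ s ∈ T}.Nonempty := by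
    by_contra hcon
    rw [Set.not_nonempty_iff_eq_empty] at hcon
    simp [lastActive, hcon] at h
  exact Nat.sSup_mem hne ⟨t, fun _ hs => hs.1.le⟩

theorem PartiallyAsync.le_lastHeard_add {V : Type*} {T : V → Set ℕ} {B : ℕ}
    (hT : PartiallyAsync T B) (i j : V) (t : ℕ) : t + 1 ≤ lastHeard T i j t + B := by
  have := (hT i j t).1
  omega

theorem lastHeard_le {V : Type*} (T : V → Set ℕ) (i j : V) (t : ℕ) : lastHeard T i j t ≤ t :=
  (lastActive_le _ _).trans (lastActive_le _ _)

theorem infoTime_le {V : Type*} [DecidableEq V] (T : V → Set ℕ) (i j : V) (t : ℕ) :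
    infoTime T i j t ≤ t := by
  unfold infoTime
  split_ifs
  · exact le_rfl
  · exact lastHeard_le T i j t

theorem PartiallyAsync.le_infoTime_add {V : Type*} [DecidableEq V] {T : V → Set ℕ} {B : ℕ}
    (hT : PartiallyAsync T B) (i j : V) (t : ℕ) : t ≤ infoTime T i j t + B := by
  unfold infoTime
  split_ifs
  · omega
  · have := hT.le_lastHeard_add i j t
    omega

/-! ### Descent with bounded delays -/

theorem sum_range_sum_window_le {c : ℕ → ℝ} (hc : ∀ t, 0 ≤ c t) (K N : ℕ) :
    ∑ t ∈ Finset.range N, ∑ s ∈ Finset.Ico (t - K) t, c s ≤ K * ∑ t ∈ Finset.range N, c t := by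
  have h1 : ∀ t ∈ Finset.range N, ∑ s ∈ Finset.Ico (t - K) t, c s =
      ∑ s ∈ Finset.range N, if t - K ≤ s ∧ s < t then c s else 0 := by
    intro t ht
    rw [← Finset.sum_filter]
    refine Finset.sum_congr ?_ fun _ _ => rfl
    ext s
    simp only [Finset.mem_Ico, Finset.mem_filter, Finset.mem_range] at ht ⊢
    omega
  rw [Finset.sum_congr rfl h1, Finset.sum_comm, Finset.mul_sum]
  refine Finset.sum_le_sum fun s _ => ?_
  rw [← Finset.sum_filter, Finset.sum_const, nsmul_eq_mul]
  refine mul_le_mul_of_nonneg_right (Nat.cast_le.2 ?_) (hc s)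
  calc _ ≤ (Finset.Ioc s (s + K)).card := Finset.card_le_card fun t ht => by
        simp only [Finset.mem_Ioc, Finset.mem_filter] at ht ⊢
        omega
    _ = K := by simp

/-- If a sequence that is bounded below decreases by `α b(t)²` up to an error `β b(s) b(t)` for
each of the `K` preceding times `s`, and `β K < α`, then `b` is square summable. -/
theorem tendsto_zero_of_delayed_descent {H b : ℕ → ℝ} {m α β : ℝ} {K : ℕ}
    (hm : ∀ t, m ≤ H t) (hβ : 0 ≤ β) (hαβ : β * K < α)
    (hstep : ∀ t, H (t + 1) ≤ H t - α * b t ^ 2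
      + β * ((∑ s ∈ Finset.Ico (t - K) t, b s) * b t)) :
    Filter.Tendsto b Filter.atTop (𝓝 0) := by
  have hwin : ∀ t, (∑ s ∈ Finset.Ico (t - K) t, b s) * b t ≤
      (∑ s ∈ Finset.Ico (t - K) t, b s ^ 2) / 2 + K / 2 * b t ^ 2 := by
    intro t
    have h1 : (∑ s ∈ Finset.Ico (t - K) t, b s) * b t ≤
        ∑ s ∈ Finset.Ico (t - K) t, (b s ^ 2 / 2 + b t ^ 2 / 2) := by
      rw [Finset.sum_mul]
      exact Finset.sum_le_sum fun s _ => by nlinarith [sq_nonneg (b s - b t)]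
    rw [Finset.sum_add_distrib, ← Finset.sum_div, Finset.sum_const, nsmul_eq_mul] at h1
    have h2 : ((Finset.Ico (t - K) t).card : ℝ) ≤ K := by
      rw [Nat.card_Ico]
      exact Nat.cast_le.2 (by omega)
    nlinarith [mul_le_mul_of_nonneg_right h2 (sq_nonneg (b t))]
  have htel : ∀ N, H N + (α - β * K / 2) * ∑ t ∈ Finset.range N, b t ^ 2 ≤
      H 0 + β / 2 * ∑ t ∈ Finset.range N, ∑ s ∈ Finset.Ico (t - K) t, b s ^ 2 := by
    intro N
    induction N with
    | zero => simp
    | succ N ih =>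
      rw [Finset.sum_range_succ, Finset.sum_range_succ]
      have := hstep N
      have := mul_le_mul_of_nonneg_left (hwin N) hβ
      linarith
  have hbd : ∀ N, ∑ t ∈ Finset.range N, b t ^ 2 ≤ (H 0 - m) / (α - β * K) := by
    intro N
    rw [le_div_iff₀ (by linarith)]
    have h1 := htel N
    have h2 := mul_le_mul_of_nonneg_left
      (sum_range_sum_window_le (fun t => sq_nonneg (b t)) K N) (by positivity : 0 ≤ β / 2)
    have h3 := hm N
    linarith
  have hsum := summable_of_sum_range_le (fun t => sq_nonneg (b t)) hbd
  have h0 := hsum.tendsto_atTop_zero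
  rw [tendsto_zero_iff_abs_tendsto_zero]
  have h1 := (Real.continuous_sqrt.tendsto 0).comp h0
  simpa [Function.comp_def, Real.sqrt_sq_eq_abs] using h1

theorem tendsto_sum_window_zero {b : ℕ → ℝ} (hb : Filter.Tendsto b Filter.atTop (𝓝 0))
    (hb0 : ∀ t, 0 ≤ b t) (K : ℕ) :
    Filter.Tendsto (fun t => ∑ s ∈ Finset.Ico (t - K) t, b s) Filter.atTop (𝓝 0) := by
  have h1 : Filter.Tendsto (fun t => ∑ k ∈ Finset.range K, b (t - K + k)) Filter.atTop
      (𝓝 (∑ k ∈ Finset.range K, 0)) := by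
    refine tendsto_finsetSum _ fun k _ => hb.comp ?_
    exact Filter.tendsto_atTop_mono (fun t => Nat.le_add_right _ _) (Filter.tendsto_sub_atTop_nat K)
  rw [Finset.sum_const_zero] at h1
  refine squeeze_zero (fun t => Finset.sum_nonneg fun s _ => hb0 s) (fun t => ?_) h1
  rw [Finset.sum_Ico_eq_sum_range]
  exact Finset.sum_le_sum_of_subset_of_nonneg
    (Finset.range_subset_range.2 (by omega)) fun k _ _ => hb0 _

theorem sum_window_mono {b : ℕ → ℝ} (hb0 : ∀ t, 0 ≤ b t) {a t a' t' : ℕ} (ha : a' ≤ a)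
    (ht : t ≤ t') : ∑ s ∈ Finset.Ico a t, b s ≤ ∑ s ∈ Finset.Ico a' t', b s :=
  Finset.sum_le_sum_of_subset_of_nonneg (Finset.Ico_subset_Ico ha ht) fun s _ _ => hb0 s

theorem norm_le_card_mul_of_abs_le {κ : Type*} [Fintype κ] {x : EuclideanSpace ℝ κ} {c : ℝ}
    (hc : 0 ≤ c) (h : ∀ e, |x e| ≤ c) : ‖x‖ ≤ Fintype.card κ * c := by
  refine le_of_sq_le_sq ?_ (by positivity)
  rw [EuclideanSpace.norm_sq_eq]
  calc ∑ e, ‖x e‖ ^ 2 ≤ ∑ _e : κ, c ^ 2 :=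
        Finset.sum_le_sum fun e _ => pow_le_pow_left₀ (norm_nonneg _) (h e) 2
    _ = Fintype.card κ * c ^ 2 := by simp
    _ ≤ (Fintype.card κ) ^ 2 * c ^ 2 := by
        refine mul_le_mul_of_nonneg_right ?_ (sq_nonneg c)
        exact_mod_cast Nat.le_self_pow two_ne_zero _
    _ = _ := by ring

/-! ### The virtual iterate -/

section Virtual

variable {V : Type*} [Fintype V] [DecidableEq V] (G : SimpleGraph V) [DecidableRel G.Adj] {p : ℕ}

open Classical in
/-- The Euclidean norm of all the gradient information that is used at time `t`, that is, of the
local views of the nodes available at time `t`. -/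
def viewNorm (T : V → Set ℕ) (g : ℕ → DualVec G p) (t : ℕ) : ℝ :=
  √(∑ j with t ∈ T j, localView G T g j t ⬝ᵥ localView G T g j t)

open Classical in
/-- The sum of all the directions that are computed at time `t`, whenever they will be applied. -/
def sentDirection (Γ : ℝ) (T : V → Set ℕ)
    (Bm : (i : V) → ℕ → Matrix (NbhdIdx G p i) (NbhdIdx G p i) ℝ) (g : ℕ → DualVec G p) (t : ℕ) :
    DualVec G p :=
  WithLp.toLp 2 fun e => ∑ j with t ∈ T j, localDirectionExt G Γ T Bm g j t e

/-- The virtual iterate, to which every direction is applied, with stepsize `ε`, at the time at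
which it is computed. It differs from the true iterate by the directions that are under way. -/
def virtualIterate (Γ ε : ℝ) (T : V → Set ℕ)
    (Bm : (i : V) → ℕ → Matrix (NbhdIdx G p i) (NbhdIdx G p i) ℝ) (g : ℕ → DualVec G p)
    (x0 : DualVec G p) (t : ℕ) : DualVec G p :=
  x0 + ε • ∑ s ∈ Finset.range t, sentDirection G Γ T Bm g s

variable {G} {f : V → EuclideanSpace ℝ (Fin p) → ℝ} {γ Γ ε : ℝ} {T : V → Set ℕ} {B : ℕ}
  {B0 : (i : V) → Matrix (NbhdIdx G p i) (NbhdIdx G p i) ℝ} {lam : ℕ → DualVec G p}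
  {Bm : (i : V) → ℕ → Matrix (NbhdIdx G p i) (NbhdIdx G p i) ℝ} {g : ℕ → DualVec G p}

theorem dotProduct_localView_self_nonneg (j : V) (t : ℕ) :
    0 ≤ localView G T g j t ⬝ᵥ localView G T g j t :=
  Finset.sum_nonneg fun e _ => mul_self_nonneg (localView G T g j t e)

theorem viewNorm_nonneg (t : ℕ) : 0 ≤ viewNorm G T g t := Real.sqrt_nonneg _

open Classical in
theorem sq_viewNorm (t : ℕ) : viewNorm G T g t ^ 2 =
    ∑ j with t ∈ T j, localView G T g j t ⬝ᵥ localView G T g j t :=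
  Real.sq_sqrt (Finset.sum_nonneg fun j _ => dotProduct_localView_self_nonneg j t)

theorem sqrt_localView_le_viewNorm {j : V} {t : ℕ} (ht : t ∈ T j) :
    √(localView G T g j t ⬝ᵥ localView G T g j t) ≤ viewNorm G T g t := by
  classical
  refine Real.sqrt_le_sqrt ?_
  exact Finset.single_le_sum (f := fun j => localView G T g j t ⬝ᵥ localView G T g j t)
    (fun j _ => dotProduct_localView_self_nonneg j t) (by simpa using ht)

theorem IsAsyncRun.abs_localDirectionExt_le {ε : ℕ → ℝ} (hγ : 0 < γ) (hΓ : 0 < Γ)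
    (hB0 : ∀ i, (B0 i).PosDef) (hrun : IsAsyncRun G f γ Γ ε T B0 lam Bm)
    {j : V} {t : ℕ} (ht : t ∈ T j) (e : G.Dart × Fin p) :
    |localDirectionExt G Γ T Bm g j t e| ≤ directionBound γ Γ B0 * viewNorm G T g t := by
  have h0 := directionBound_nonneg (B0 := B0) hγ hΓ
  unfold localDirectionExt
  split_ifs with h
  · exact (hrun.abs_localDirection_le hγ hΓ hB0 g j t _).trans
      (mul_le_mul_of_nonneg_left (sqrt_localView_le_viewNorm ht) h0)
  · rw [abs_zero]
    exact mul_nonneg h0 (viewNorm_nonneg t)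

theorem sentDirection_apply [∀ j, DecidablePred (· ∈ T j)] (t : ℕ) (e : G.Dart × Fin p) :
    sentDirection G Γ T Bm g t e =
      (if t ∈ T e.1.fst then localDirectionExt G Γ T Bm g e.1.fst t e else 0) +
      ∑ j ∈ G.neighborFinset e.1.fst,
        if t ∈ T j then localDirectionExt G Γ T Bm g j t e else 0 := by
  have h1 : sentDirection G Γ T Bm g t e =
      ∑ j, if t ∈ T j then localDirectionExt G Γ T Bm g j t e else 0 := by
    rw [← Finset.sum_filter, sentDirection]
    congr!
  rw [h1, ← Finset.sum_insert (s := G.neighborFinset e.1.fst) (a := e.1.fst)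
    (f := fun j => if t ∈ T j then localDirectionExt G Γ T Bm g j t e else 0) (by simp)]
  refine (Finset.sum_subset (Finset.subset_univ _) fun j _ hj => ?_).symm
  simp only [Finset.mem_insert, SimpleGraph.mem_neighborFinset, not_or] at hj
  have h2 : ¬ (e.1.fst = j ∨ G.Adj j e.1.fst) := by
    rintro (h | h)
    · exact hj.1 h.symm
    · exact hj.2 h.symm
  simp [localDirectionExt, h2]

/-- With a constant stepsize, the own directions of node `i` have been applied up to time `t`, and
those of its neighbors up to time `π^i(π^i(t))`: at each activation the window of newly received
messages starts where the preceding one ended. -/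
theorem IsAsyncRun.iterate_apply (hrun : IsAsyncRun G f γ Γ (fun _ => ε) T B0 lam Bm)
    [∀ j, DecidablePred (· ∈ T j)] (t : ℕ) (e : G.Dart × Fin p) :
    lam t e = lam 0 e + ε *
      ((∑ s ∈ Finset.range t, if s ∈ T e.1.fst then
          localDirectionExt G Γ T Bm (fun s => dualGrad G f (lam s)) e.1.fst s e else 0) +
        ∑ j ∈ G.neighborFinset e.1.fst, ∑ s ∈ Finset.range (lastHeard T e.1.fst e.1.fst t),
          if s ∈ T j then
            localDirectionExt G Γ T Bm (fun s => dualGrad G f (lam s)) j s e else 0) := by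
  induction t with
  | zero => simp [lastHeard, lastActive_zero]
  | succ t ih =>
    rw [hrun.step, ih, Finset.sum_range_succ, appliedDirection]
    by_cases ht : t ∈ T e.1.fst
    · rw [if_pos ht, if_pos ht]
      have h1 : lastHeard T e.1.fst e.1.fst (t + 1) = lastActive (T e.1.fst) t := by
        rw [lastHeard, lastActive_succ_of_mem ht]
      have h2 : ∀ j, ∑ s ∈ newMessages T e.1.fst j t,
          localDirectionExt G Γ T Bm (fun s => dualGrad G f (lam s)) j s e =
          ∑ s ∈ Finset.Ico (lastHeard T e.1.fst e.1.fst t) (lastActive (T e.1.fst) t),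
            if s ∈ T j then
              localDirectionExt G Γ T Bm (fun s => dualGrad G f (lam s)) j s e else 0 := by
        intro j
        rw [← Finset.sum_filter]
        refine Finset.sum_congr ?_ fun _ _ => rfl
        ext s
        have := lastActive_le (T e.1.fst) t
        simp only [newMessages, lastHeard, Finset.mem_filter, Finset.mem_range, Finset.mem_Ico]
        constructor
        · rintro ⟨-, h3, h4⟩
          exact ⟨h4, h3⟩
        · rintro ⟨h4, h3⟩
          exact ⟨by omega, h3, h4⟩
      have h3 : lastHeard T e.1.fst e.1.fst t ≤ lastActive (T e.1.fst) t := lastActive_le _ _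
      simp only [h1, h2, ← Finset.sum_range_add_sum_Ico _ h3, Finset.sum_add_distrib]
      ring
    · rw [if_neg ht, if_neg ht]
      have h1 : lastHeard T e.1.fst e.1.fst (t + 1) = lastHeard T e.1.fst e.1.fst t := by
        rw [lastHeard, lastActive_succ_of_notMem ht, lastHeard]
      rw [h1]
      ring

theorem virtualIterate_succ (x0 : DualVec G p) (t : ℕ) :
    virtualIterate G Γ ε T Bm g x0 (t + 1) =
      virtualIterate G Γ ε T Bm g x0 t + ε • sentDirection G Γ T Bm g t := by
  rw [virtualIterate, virtualIterate, Finset.sum_range_succ, smul_add, add_assoc]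

theorem virtualIterate_apply (x0 : DualVec G p) (t : ℕ) (e : G.Dart × Fin p) :
    virtualIterate G Γ ε T Bm g x0 t e =
      x0 e + ε * ∑ s ∈ Finset.range t, sentDirection G Γ T Bm g s e := by
  simp [virtualIterate]

theorem IsAsyncRun.abs_sentDirection_le {ε : ℕ → ℝ} (hγ : 0 < γ) (hΓ : 0 < Γ)
    (hB0 : ∀ i, (B0 i).PosDef) (hrun : IsAsyncRun G f γ Γ ε T B0 lam Bm) (t : ℕ)
    (e : G.Dart × Fin p) :
    |sentDirection G Γ T Bm g t e| ≤
      Fintype.card V * (directionBound γ Γ B0 * viewNorm G T g t) := by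
  classical
  have h0 := mul_nonneg (directionBound_nonneg (B0 := B0) hγ hΓ)
    (viewNorm_nonneg (T := T) (g := g) t)
  have h1 : sentDirection G Γ T Bm g t e =
      ∑ j with t ∈ T j, localDirectionExt G Γ T Bm g j t e := by
    simp only [sentDirection]
  rw [h1]
  refine (Finset.abs_sum_le_sum_abs _ _).trans ((Finset.sum_le_card_nsmul _ _ _ fun j hj =>
    hrun.abs_localDirectionExt_le hγ hΓ hB0 (Finset.mem_filter.1 hj).2 e).trans ?_)
  rw [nsmul_eq_mul]
  exact mul_le_mul_of_nonneg_right (Nat.cast_le.2 (Finset.card_le_univ _)) h0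

/-- The directions that are under way at time `t` were computed in the last `B` units of time. -/
theorem IsAsyncRun.abs_virtualIterate_sub_le (hγ : 0 < γ) (hΓ : 0 < Γ) (hε : 0 ≤ ε)
    (hB0 : ∀ i, (B0 i).PosDef) (hT : PartiallyAsync T B)
    (hrun : IsAsyncRun G f γ Γ (fun _ => ε) T B0 lam Bm) (t : ℕ) (e : G.Dart × Fin p) :
    |virtualIterate G Γ ε T Bm (fun s => dualGrad G f (lam s)) (lam 0) t e - lam t e| ≤
      ε * (Fintype.card V * directionBound γ Γ B0) *
        ∑ s ∈ Finset.Ico (t - B) t, viewNorm G T (fun s => dualGrad G f (lam s)) s := by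
  classical
  set g : ℕ → DualVec G p := fun s => dualGrad G f (lam s)
  have hM := directionBound_nonneg (B0 := B0) hγ hΓ
  have hle : lastHeard T e.1.fst e.1.fst t ≤ t := lastHeard_le _ _ _ _
  have h1 : virtualIterate G Γ ε T Bm g (lam 0) t e - lam t e = ε *
      ∑ j ∈ G.neighborFinset e.1.fst, ∑ s ∈ Finset.Ico (lastHeard T e.1.fst e.1.fst t) t,
        if s ∈ T j then localDirectionExt G Γ T Bm g j s e else 0 := by
    rw [virtualIterate_apply, hrun.iterate_apply t e]
    simp only [sentDirection_apply, Finset.sum_add_distrib]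
    rw [Finset.sum_comm (s := Finset.range t)]
    simp only [← Finset.sum_range_add_sum_Ico _ hle, Finset.sum_add_distrib]
    ring
  rw [h1, abs_mul, abs_of_nonneg hε, mul_assoc]
  refine mul_le_mul_of_nonneg_left ?_ hε
  have hnn : ∀ s, 0 ≤ viewNorm G T g s := viewNorm_nonneg
  have h2 : ∀ j ∈ G.neighborFinset e.1.fst,
      |∑ s ∈ Finset.Ico (lastHeard T e.1.fst e.1.fst t) t,
        if s ∈ T j then localDirectionExt G Γ T Bm g j s e else 0| ≤
      directionBound γ Γ B0 * ∑ s ∈ Finset.Ico (t - B) t, viewNorm G T g s := by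
    intro j _
    have h3 : t - B ≤ lastHeard T e.1.fst e.1.fst t := by
      have := hT.le_lastHeard_add e.1.fst e.1.fst t
      omega
    refine (Finset.abs_sum_le_sum_abs _ _).trans
      (le_trans ?_ (mul_le_mul_of_nonneg_left (sum_window_mono hnn h3 le_rfl) hM))
    rw [Finset.mul_sum]
    refine Finset.sum_le_sum fun s _ => ?_
    split_ifs with hs
    · exact hrun.abs_localDirectionExt_le hγ hΓ hB0 hs e
    · rw [abs_zero]
      exact mul_nonneg hM (hnn s)
  refine (Finset.abs_sum_le_sum_abs _ _).trans ((Finset.sum_le_card_nsmul _ _ _ h2).trans ?_)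
  rw [nsmul_eq_mul, mul_assoc]
  refine mul_le_mul_of_nonneg_right (Nat.cast_le.2 (Finset.card_le_univ _)) ?_
  exact mul_nonneg hM (Finset.sum_nonneg fun s _ => hnn s)

theorem IsAsyncRun.abs_virtualIterate_sub_virtualIterate_le {ε' : ℕ → ℝ} (hγ : 0 < γ)
    (hΓ : 0 < Γ) (hε : 0 ≤ ε) (hB0 : ∀ i, (B0 i).PosDef)
    (hrun : IsAsyncRun G f γ Γ ε' T B0 lam Bm) (x0 : DualVec G p) {t t' : ℕ} (ht : t' ≤ t)
    (e : G.Dart × Fin p) :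
    |virtualIterate G Γ ε T Bm g x0 t e - virtualIterate G Γ ε T Bm g x0 t' e| ≤
      ε * (Fintype.card V * directionBound γ Γ B0) *
        ∑ s ∈ Finset.Ico t' t, viewNorm G T g s := by
  have h1 : virtualIterate G Γ ε T Bm g x0 t e - virtualIterate G Γ ε T Bm g x0 t' e =
      ε * ∑ s ∈ Finset.Ico t' t, sentDirection G Γ T Bm g s e := by
    rw [virtualIterate_apply, virtualIterate_apply, ← Finset.sum_range_add_sum_Ico _ ht]
    ring
  rw [h1, abs_mul, abs_of_nonneg hε, mul_assoc]
  refine mul_le_mul_of_nonneg_left ?_ hε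
  rw [Finset.mul_sum]
  refine (Finset.abs_sum_le_sum_abs _ _).trans (Finset.sum_le_sum fun s _ => ?_)
  rw [mul_assoc]
  exact hrun.abs_sentDirection_le hγ hΓ hB0 s e

/-- The true iterates of the last `B` units of time are close to the current virtual one. -/
theorem IsAsyncRun.norm_virtualIterate_sub_le (hγ : 0 < γ) (hΓ : 0 < Γ) (hε : 0 ≤ ε)
    (hB0 : ∀ i, (B0 i).PosDef) (hT : PartiallyAsync T B)
    (hrun : IsAsyncRun G f γ Γ (fun _ => ε) T B0 lam Bm) {t t' : ℕ} (ht : t' ≤ t)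
    (ht' : t ≤ t' + B) :
    ‖virtualIterate G Γ ε T Bm (fun s => dualGrad G f (lam s)) (lam 0) t - lam t'‖ ≤
      Fintype.card (G.Dart × Fin p) * (ε * (Fintype.card V * directionBound γ Γ B0) *
        (2 * ∑ s ∈ Finset.Ico (t - 2 * B) t,
          viewNorm G T (fun s => dualGrad G f (lam s)) s)) := by
  set g : ℕ → DualVec G p := fun s => dualGrad G f (lam s)
  have hnn : ∀ s, 0 ≤ viewNorm G T g s := viewNorm_nonneg
  have hC : 0 ≤ ε * (Fintype.card V * directionBound γ Γ B0) :=
    mul_nonneg hε (mul_nonneg (Nat.cast_nonneg _) (directionBound_nonneg hγ hΓ))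
  refine norm_le_card_mul_of_abs_le (mul_nonneg hC
    (mul_nonneg two_pos.le (Finset.sum_nonneg fun s _ => hnn s))) fun e => ?_
  have h1 := hrun.abs_virtualIterate_sub_virtualIterate_le (g := g) hγ hΓ hε hB0 (lam 0) ht e
  have h2 := hrun.abs_virtualIterate_sub_le hγ hΓ hε hB0 hT t' e
  have h3 := mul_le_mul_of_nonneg_left
    (sum_window_mono hnn (show t - 2 * B ≤ t' by omega) (le_refl t)) hC
  have h4 := mul_le_mul_of_nonneg_left
    (sum_window_mono hnn (show t - 2 * B ≤ t' - B by omega) ht) hC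
  have h5 := abs_sub_le (virtualIterate G Γ ε T Bm g (lam 0) t e)
    (virtualIterate G Γ ε T Bm g (lam 0) t' e) (lam t' e)
  rw [PiLp.sub_apply]
  linarith

end Virtual

/-! ### Convergence -/

section Convergence

variable {V : Type*} [Fintype V] [DecidableEq V] {G : SimpleGraph V} [DecidableRel G.Adj] {p : ℕ}
  {f : V → EuclideanSpace ℝ (Fin p) → ℝ} {μ γ Γ ε : ℝ} {T : V → Set ℕ} {B : ℕ}
  {B0 : (i : V) → Matrix (NbhdIdx G p i) (NbhdIdx G p i) ℝ} {lam : ℕ → DualVec G p}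
  {Bm : (i : V) → ℕ → Matrix (NbhdIdx G p i) (NbhdIdx G p i) ℝ} {g : ℕ → DualVec G p}

theorem sum_mul_localDirectionExt (y : DualVec G p) (j : V) (t : ℕ) :
    ∑ e, y e * localDirectionExt G Γ T Bm g j t e =
      ∑ e : NbhdIdx G p j, y (e.1.1, e.2) * localDirection G Γ T Bm g j t e := by
  refine (Fintype.sum_of_injective (fun e : NbhdIdx G p j => (e.1.1, e.2)) ?_ _ _ ?_ ?_).symm
  · rintro ⟨⟨d, hd⟩, a⟩ ⟨⟨d', hd'⟩, a'⟩ h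
    simpa using h
  · intro e he
    have : ¬ (e.1.fst = j ∨ G.Adj j e.1.fst) := fun h => he ⟨(⟨e.1, h⟩, e.2), rfl⟩
    simp [localDirectionExt, this]
  · intro e
    simp [localDirectionExt, e.1.2]

/-- If the true gradient `y` at the point of interest is within `η` of every local view, then the
sum of all the directions computed at time `t` is a descent direction up to an error in `η`. -/
theorem IsAsyncRun.inner_sentDirection_le {ε : ℕ → ℝ} (hγ : 0 < γ) (hΓ : 0 < Γ)
    (hB0 : ∀ i, (B0 i).PosDef) (hrun : IsAsyncRun G f γ Γ ε T B0 lam Bm) {t : ℕ}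
    {y : DualVec G p} {η : ℝ} (hη : 0 ≤ η)
    (hy : ∀ j, ∀ e : NbhdIdx G p j, |y (e.1.1, e.2) - localView G T g j t e| ≤ η) :
    inner ℝ y (sentDirection G Γ T Bm g t) ≤
      -(Γ / (Fintype.card V + 1) * viewNorm G T g t ^ 2) +
      Fintype.card V * (Fintype.card (G.Dart × Fin p) *
        (η * (directionBound γ Γ B0 * viewNorm G T g t))) := by
  classical
  have hb := mul_nonneg (directionBound_nonneg (B0 := B0) hγ hΓ)
    (viewNorm_nonneg (T := T) (g := g) t)
  set R := Fintype.card (G.Dart × Fin p) * (η * (directionBound γ Γ B0 * viewNorm G T g t))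
    with hR
  have hR0 : 0 ≤ R := mul_nonneg (Nat.cast_nonneg _) (mul_nonneg hη hb)
  have h1 : inner ℝ y (sentDirection G Γ T Bm g t) =
      ∑ j with t ∈ T j, ∑ e : NbhdIdx G p j, y (e.1.1, e.2) * localDirection G Γ T Bm g j t e := by
    simp only [← sum_mul_localDirectionExt]
    rw [Finset.sum_comm, PiLp.inner_apply]
    refine Finset.sum_congr rfl fun e _ => ?_
    simp only [sentDirection, RCLike.inner_apply, conj_trivial]
    rw [mul_comm, Finset.mul_sum]
  have h2 : ∀ j ∈ Finset.univ.filter (fun j => t ∈ T j),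
      ∑ e : NbhdIdx G p j, y (e.1.1, e.2) * localDirection G Γ T Bm g j t e ≤
      -(Γ / (Fintype.card V + 1) * (localView G T g j t ⬝ᵥ localView G T g j t)) + R := by
    intro j hj
    have hj : t ∈ T j := (Finset.mem_filter.1 hj).2
    have h3 := hrun.localView_dotProduct_localDirection_le hγ hΓ hB0 g j t
    have h4 : ∑ e : NbhdIdx G p j, y (e.1.1, e.2) * localDirection G Γ T Bm g j t e =
        localView G T g j t ⬝ᵥ localDirection G Γ T Bm g j t + ∑ e : NbhdIdx G p j,
          (y (e.1.1, e.2) - localView G T g j t e) * localDirection G Γ T Bm g j t e := by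
      rw [dotProduct, ← Finset.sum_add_distrib]
      exact Finset.sum_congr rfl fun e _ => by ring
    have h5 : ∑ e : NbhdIdx G p j,
        (y (e.1.1, e.2) - localView G T g j t e) * localDirection G Γ T Bm g j t e ≤ R := by
      refine (Finset.sum_le_card_nsmul _ _ (η * (directionBound γ Γ B0 * viewNorm G T g t))
        fun e _ => ?_).trans ?_
      · refine (le_abs_self _).trans ?_
        rw [abs_mul]
        refine mul_le_mul (hy j e) ?_ (abs_nonneg _) hη
        exact (hrun.abs_localDirection_le hγ hΓ hB0 g j t e).trans (mul_le_mul_of_nonneg_left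
          (sqrt_localView_le_viewNorm hj) (directionBound_nonneg hγ hΓ))
      · rw [nsmul_eq_mul]
        refine mul_le_mul_of_nonneg_right (Nat.cast_le.2 ?_) (mul_nonneg hη hb)
        rw [Finset.card_univ]
        refine Fintype.card_le_of_injective (fun e : NbhdIdx G p j => (e.1.1, e.2)) ?_
        rintro ⟨⟨d, hd⟩, a⟩ ⟨⟨d', hd'⟩, a'⟩ h
        simpa using h
    rw [h4]
    exact add_le_add h3 h5
  rw [h1]
  refine (Finset.sum_le_sum h2).trans ?_
  rw [Finset.sum_add_distrib, Finset.sum_neg_distrib, ← Finset.mul_sum, Finset.sum_const,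
    nsmul_eq_mul]
  have h6 : viewNorm G T g t ^ 2 =
      ∑ j with t ∈ T j, localView G T g j t ⬝ᵥ localView G T g j t := by
    rw [sq_viewNorm]
  rw [h6]
  have h7 : ((Finset.univ.filter (fun j => t ∈ T j)).card : ℝ) ≤ Fintype.card V :=
    Nat.cast_le.2 (Finset.card_le_univ _)
  linarith [mul_le_mul_of_nonneg_right h7 hR0]

theorem abs_apply_sub_le_norm_sub {κ : Type*} [Fintype κ] (x y : EuclideanSpace ℝ κ) (e : κ) :
    |x e - y e| ≤ ‖x - y‖ := by
  simpa using PiLp.norm_apply_le (x - y) e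

/-- For a stepsize below a constant that does not depend on the run, the local views that are used
tend to `0`: the dual function decreases along the virtual iterates, up to delay errors. -/
theorem IsAsyncRun.tendsto_viewNorm (hμ : 0 < μ) (hdiff : ∀ i, Differentiable ℝ (f i))
    (hconc : ∀ i, StrongConcaveOn Set.univ μ (f i)) (hγ : 0 < γ) (hΓ : 0 < Γ) (hε : 0 < ε)
    (hB0 : ∀ i, (B0 i).PosDef) (hT : PartiallyAsync T B)
    (hrun : IsAsyncRun G f γ Γ (fun _ => ε) T B0 lam Bm)
    (hsmall : ε * (dualLip G μ * (Fintype.card (G.Dart × Fin p) *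
      (Fintype.card V * directionBound γ Γ B0)) ^ 2 * (4 * B + 1)) < Γ / (Fintype.card V + 1)) :
    Filter.Tendsto (viewNorm G T fun s => dualGrad G f (lam s)) Filter.atTop (𝓝 0) := by
  set g : ℕ → DualVec G p := fun s => dualGrad G f (lam s) with hg
  set b := viewNorm G T g with hb
  set L := dualLip G μ with hL
  set M := directionBound γ Γ B0 with hM
  set n := (Fintype.card V : ℝ) with hn
  set N := (Fintype.card (G.Dart × Fin p) : ℝ) with hN
  set z := virtualIterate G Γ ε T Bm g (lam 0) with hz
  have hnn : ∀ s, 0 ≤ b s := viewNorm_nonneg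
  have hL0 : 0 ≤ L := dualLip_nonneg hμ
  have hM0 : 0 ≤ M := directionBound_nonneg hγ hΓ
  have hn0 : 0 ≤ n := Nat.cast_nonneg _
  have hN0 : 0 ≤ N := Nat.cast_nonneg _
  refine tendsto_zero_of_delayed_descent (H := fun t => dualFun G f (z t)) (K := 2 * B)
    (α := ε * (Γ / (n + 1)) - ε ^ 2 * (L * (N * (n * M)) ^ 2))
    (β := ε ^ 2 * (2 * (L * (N * (n * M)) ^ 2)))
    (fun t => sum_apply_zero_le_dualFun hμ hdiff hconc (z t)) (by positivity) ?_ fun t => ?_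
  · have := mul_lt_mul_of_pos_left hsmall hε
    push_cast
    linarith
  · set w := ∑ s ∈ Finset.Ico (t - 2 * B) t, b s with hw
    have hw0 : 0 ≤ w := Finset.sum_nonneg fun s _ => hnn s
    set η := L * (N * (ε * (n * M) * (2 * w))) with hη
    have hview : ∀ j, ∀ e : NbhdIdx G p j,
        |dualGrad G f (z t) (e.1.1, e.2) - localView G T g j t e| ≤ η := by
      intro j e
      refine (abs_apply_sub_le_norm_sub _ _ _).trans
        ((norm_dualGrad_sub_le hμ hdiff hconc _ _).trans (mul_le_mul_of_nonneg_left ?_ hL0))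
      exact hrun.norm_virtualIterate_sub_le hγ hΓ hε.le hB0 hT (infoTime_le _ _ _ _)
        (hT.le_infoTime_add _ _ _)
    have h1 := hrun.inner_sentDirection_le hγ hΓ hB0 (by positivity : 0 ≤ η) hview
    have h2 : ‖sentDirection G Γ T Bm g t‖ ≤ N * (n * (M * b t)) :=
      norm_le_card_mul_of_abs_le (mul_nonneg hn0 (mul_nonneg hM0 (hnn t)))
        fun e => hrun.abs_sentDirection_le hγ hΓ hB0 t e
    have h3 := dualFun_le hμ hdiff hconc (z t) (z (t + 1))
    have h4 : z (t + 1) - z t = ε • sentDirection G Γ T Bm g t := by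
      rw [hz, virtualIterate_succ, add_sub_cancel_left]
    rw [h4, inner_smul_right, norm_smul, Real.norm_of_nonneg hε.le, mul_pow] at h3
    have h5 := mul_le_mul_of_nonneg_left (pow_le_pow_left₀ (norm_nonneg _) h2 2)
      (by positivity : 0 ≤ L * ε ^ 2)
    have h6 := mul_le_mul_of_nonneg_left h1 hε.le
    rw [hη] at h6
    linarith

/-- The gradient is recovered from the view norms: node `i` has recently used its own block. -/
theorem IsAsyncRun.norm_dualGrad_le (hμ : 0 < μ) (hdiff : ∀ i, Differentiable ℝ (f i))
    (hconc : ∀ i, StrongConcaveOn Set.univ μ (f i)) (hγ : 0 < γ) (hΓ : 0 < Γ) (hε : 0 ≤ ε)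
    (hB0 : ∀ i, (B0 i).PosDef) (hT : PartiallyAsync T B)
    (hrun : IsAsyncRun G f γ Γ (fun _ => ε) T B0 lam Bm) {t : ℕ} (ht : B ≤ t) :
    ‖dualGrad G f (lam t)‖ ≤ Fintype.card (G.Dart × Fin p) * ((1 + 2 * (dualLip G μ *
      (Fintype.card (G.Dart × Fin p) * (ε * (Fintype.card V * directionBound γ Γ B0) * 2)))) *
      ∑ s ∈ Finset.Ico (t - 2 * B) t, viewNorm G T (fun s => dualGrad G f (lam s)) s) := by
  classical
  set g : ℕ → DualVec G p := fun s => dualGrad G f (lam s) with hg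
  set w := ∑ s ∈ Finset.Ico (t - 2 * B) t, viewNorm G T g s with hw
  have hw0 : 0 ≤ w := Finset.sum_nonneg fun s _ => viewNorm_nonneg s
  have hL0 := dualLip_nonneg (G := G) hμ
  have hM0 := directionBound_nonneg (B0 := B0) hγ hΓ
  refine norm_le_card_mul_of_abs_le (by positivity) fun e => ?_
  -- the last activation of the owner of the coordinate `e`
  set s := lastActive (T e.1.fst) t with hs
  have h1 := hT.le_lastHeard_add e.1.fst e.1.fst t
  have h2 : lastHeard T e.1.fst e.1.fst t ≤ s := lastActive_le _ _
  have hsT : s < t ∧ s ∈ T e.1.fst := lastActive_mem (by omega)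
  have h3 : |g s e| ≤ w := by
    have h4 : localView G T g e.1.fst s (⟨e.1, Or.inl rfl⟩, e.2) = g s e := by
      simp [localView, infoTime]
    rw [← h4]
    refine (abs_le_sqrt_dotProduct_self _ _).trans ((sqrt_localView_le_viewNorm hsT.2).trans ?_)
    exact Finset.single_le_sum (f := viewNorm G T g) (fun s _ => viewNorm_nonneg s)
      (Finset.mem_Ico.2 ⟨by omega, hsT.1⟩)
  set z := virtualIterate G Γ ε T Bm g (lam 0) t with hz
  have h5 := hrun.norm_virtualIterate_sub_le hγ hΓ hε hB0 hT (le_refl t) (by omega)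
  have h6 := hrun.norm_virtualIterate_sub_le hγ hΓ hε hB0 hT hsT.1.le (by omega)
  have h7 : ‖lam t - lam s‖ ≤ ‖z - lam t‖ + ‖z - lam s‖ := by
    rw [norm_sub_rev z (lam t)]
    exact norm_sub_le_norm_sub_add_norm_sub _ _ _
  have h8 := norm_dualGrad_sub_le hμ hdiff hconc (lam s) (lam t)
  have h9 := abs_apply_sub_le_norm_sub (dualGrad G f (lam t)) (dualGrad G f (lam s)) e
  have h10 : |dualGrad G f (lam t) e| ≤
      |dualGrad G f (lam t) e - dualGrad G f (lam s) e| + |dualGrad G f (lam s) e| := by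
    simpa using abs_add_le (dualGrad G f (lam t) e - dualGrad G f (lam s) e)
      (dualGrad G f (lam s) e)
  have h11 := mul_le_mul_of_nonneg_left (h7.trans (add_le_add h5 h6)) hL0
  have h12 : |dualGrad G f (lam s) e| ≤ w := h3
  linarith

end Convergence

end DBFGS

end

theorem theorem2 {V : Type*} [Fintype V] [DecidableEq V] (G : SimpleGraph V) [DecidableRel G.Adj]
    (hG : G.Connected) (p : ℕ) (f : V → EuclideanSpace ℝ (Fin p) → ℝ) (μ : ℝ) (hμ : 0 < μ)
    (hdiff : ∀ i, Differentiable ℝ (f i)) (hconc : ∀ i, StrongConcaveOn Set.univ μ (f i))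
    (γ Γ : ℝ) (hγ : 0 < γ) (hΓ : 0 < Γ)
    (B0 : (i : V) → Matrix (DBFGS.NbhdIdx G p i) (DBFGS.NbhdIdx G p i) ℝ)
    (hB0 : ∀ i, (B0 i).PosDef) (B : ℕ) (hB : 0 < B) :
    ∃ ε : ℕ → ℝ, (∀ t, 0 < ε t) ∧
      ∀ T : V → Set ℕ, DBFGS.PartiallyAsync T B →
      ∀ (lam : ℕ → DBFGS.DualVec G p)
        (Bm : (i : V) → ℕ → Matrix (DBFGS.NbhdIdx G p i) (DBFGS.NbhdIdx G p i) ℝ),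
        DBFGS.IsAsyncRun G f γ Γ ε T B0 lam Bm →
          (∀ t, HasGradientAt (DBFGS.dualFun G f) (DBFGS.dualGrad G f (lam t)) (lam t)) ∧
          Filter.Tendsto (fun t => DBFGS.dualGrad G f (lam t)) Filter.atTop (𝓝 0) := by
  set X : ℝ := DBFGS.dualLip G μ * (Fintype.card (G.Dart × Fin p) *
      (Fintype.card V * DBFGS.directionBound γ Γ B0)) ^ 2 * (4 * B + 1) with hX
  have hX0 : 0 ≤ X := by
    have := DBFGS.dualLip_nonneg (G := G) hμ
    positivity
  set c : ℝ := Γ / (Fintype.card V + 1) with hc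
  have hc0 : 0 < c := by positivity
  refine ⟨fun _ => c / (X + 1), fun _ => by positivity, fun T hT lam Bm hrun =>
    ⟨fun t => DBFGS.hasGradientAt_dualFun hμ hdiff hconc (lam t), ?_⟩⟩
  have hsmall : c / (X + 1) * X < c := by
    rw [div_mul_eq_mul_div, div_lt_iff₀ (by positivity)]
    linarith
  have h1 := hrun.tendsto_viewNorm hμ hdiff hconc hγ hΓ (by positivity) hB0 hT hsmall
  have h2 := ((DBFGS.tendsto_sum_window_zero h1 DBFGS.viewNorm_nonneg (2 * B)).const_mul
    (1 + 2 * (DBFGS.dualLip G μ * (Fintype.card (G.Dart × Fin p) *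
      (c / (X + 1) * (Fintype.card V * DBFGS.directionBound γ Γ B0) * 2))))).const_mul
      (Fintype.card (G.Dart × Fin p) : ℝ)
  rw [mul_zero, mul_zero] at h2
  refine squeeze_zero_norm' ?_ h2
  filter_upwards [Filter.eventually_ge_atTop B] with t ht
  exact hrun.norm_dualGrad_le hμ hdiff hconc hγ hΓ (by positivity) hB0 hT ht
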